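/- Let $0 \le k \le n$ be integers. For $x \in \{0,1,2\}^n$ write $|x| = \sum_{i=1}^n x_i$. Call a subset $A \subseteq \{0,1,2\}^n$ admissible if there are no two distinct elements $x, y \in A$ such that $x_i \le y_i$ for all $1 \le i \le n$ and $x_i < y_i$ for at most $k$ coordinates $i$. Then the set $$B = \{x \in \{0,1,2\}^n : |x| \equiv n \pmod{2k+1}\}$$ is admissible, and every admissible set $A$ satisfies $|A| \le |B|$. Moreover, if $k \ne 1$, then $B$ is the unique largest admissible set: every admissible set $A$ with $|A| = |B|$ equals $B$. -/

import Mathlib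

/-- The coordinate sum `|x| = ∑ i, x i` (a natural number) of a point of `{0, 1, 2}^n`. -/
def coordSum {n : ℕ} (x : Fin n → Fin 3) : ℕ := ∑ i, (x i : ℕ)

/-- `A ⊆ {0, 1, 2}^n` contains no two distinct elements `x ≤ y` (coordinatewise) with
`x i < y i` for at most `k` coordinates `i`. -/
def Admissible {n : ℕ} (k : ℕ) (A : Finset (Fin n → Fin 3)) : Prop :=
  ¬ ∃ x ∈ A, ∃ y ∈ A, x ≠ y ∧ (∀ i, x i ≤ y i) ∧
    (Finset.univ.filter fun i : Fin n => x i < y i).card ≤ k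

/-- The set `{x ∈ {0, 1, 2}^n : |x| ≡ n (mod 2k + 1)}`. -/
def middleLayers (n k : ℕ) : Finset (Fin n → Fin 3) :=
  Finset.univ.filter fun x => coordSum x ≡ n [MOD 2 * k + 1]

open Finset

/-! Raise `j` coordinates from 0 to 2 one after another, keeping the others fixed. Any two of the
`2j + 1` words so obtained are comparable and differ in at most `j` places, so for `j ≤ k` an
admissible set contains at most one of them. The set `B` contains exactly one if `j = k` (the chain
runs through `2k + 1` consecutive levels), or if the fixed part is balanced, with as many zeros as
twos (the levels are symmetric about `n`).

It remains to count all words by such chains. After averaging over coordinate permutations only the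
type (numbers of zeros, ones and twos) matters. Adding a free coordinate to a chain with `j ≥ 1`
raised coordinates is, on types, the splitting of a product of chains of lengths `2j + 1` and 3 into
chains of lengths `2j + 3`, `2j + 1`, `2j - 1` (`extSum_succ_right`). All three keep a balanced
fixed part balanced. Once `j = k` the fixed part may be arbitrary, so further coordinates are simply
fixed. Hence `|B| - |A|` is a sum of nonnegative chain defects (`ChainNonneg.extSum_balanced`).

In case of equality every defect in the sum vanishes. For `k ≥ 2` this forces level `n` into `A`.
The full chains carry this to the levels `n + (2k + 1)t`, and the reflection `0 ↔ 2` gives the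
levels below `n`. -/

/-! ### Words up to permutation of coordinates. -/

/-- The number of coordinates of `w` equal to `v`. -/
def valCount {n : ℕ} (v : Fin 3) (w : Fin n → Fin 3) : ℕ :=
  (univ.filter fun l => w l = v).card

theorem valCount_comp_perm {n : ℕ} (v : Fin 3) (w : Fin n → Fin 3) (σ : Equiv.Perm (Fin n)) :
    valCount v (w ∘ σ) = valCount v w := by
  unfold valCount
  refine card_equiv σ fun l => ?_
  simp

theorem exists_perm_comp_eq {n : ℕ} {w w' : Fin n → Fin 3}
    (h : ∀ v, valCount v w = valCount v w') : ∃ σ : Equiv.Perm (Fin n), w' ∘ σ = w := by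
  have e : ∀ v, Nonempty ({l // w l = v} ≃ {l // w' l = v}) := fun v => by
    refine ⟨Fintype.equivOfCardEq ?_⟩
    rw [Fintype.card_subtype, Fintype.card_subtype]
    exact h v
  refine ⟨Equiv.ofFiberEquiv fun v => (e v).some, ?_⟩
  funext l
  exact Equiv.ofFiberEquiv_map _ l

theorem coordSum_eq_valCount {n : ℕ} (w : Fin n → Fin 3) :
    coordSum w = valCount 1 w + 2 * valCount 2 w := by
  unfold coordSum valCount
  rw [card_filter, card_filter, mul_sum, ← sum_add_distrib]
  refine sum_congr rfl fun l _ => ?_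
  generalize w l = v
  fin_cases v <;> rfl

theorem sum_valCount {n : ℕ} (w : Fin n → Fin 3) :
    valCount 0 w + valCount 1 w + valCount 2 w = n := by
  unfold valCount
  rw [card_filter, card_filter, card_filter, ← sum_add_distrib, ← sum_add_distrib]
  have : ∀ l ∈ (univ : Finset (Fin n)), (((if w l = 0 then 1 else 0) + if w l = 1 then 1 else 0) +
      if w l = 2 then 1 else 0) = 1 := fun l _ => by
    generalize w l = v
    fin_cases v <;> rfl
  rw [sum_congr rfl this]
  simp

theorem coordSum_comp_perm {n : ℕ} (w : Fin n → Fin 3) (σ : Equiv.Perm (Fin n)) :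
    coordSum (w ∘ σ) = coordSum w := by
  rw [coordSum_eq_valCount, coordSum_eq_valCount, valCount_comp_perm, valCount_comp_perm]

theorem mem_middleLayers {n k : ℕ} {x : Fin n → Fin 3} :
    x ∈ middleLayers n k ↔ coordSum x ≡ n [MOD 2 * k + 1] := by
  simp [middleLayers]

/-! ### Averaging a set over permutations of coordinates. -/

/-- The proportion of permutations of the coordinates that carry `w` into `A`. -/
def permFreq {n : ℕ} (A : Finset (Fin n → Fin 3)) (w : Fin n → Fin 3) : ℚ :=
  (∑ σ : Equiv.Perm (Fin n), if w ∘ σ ∈ A then 1 else 0) / (n.factorial : ℚ)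

theorem permFreq_comp_perm {n : ℕ} (A : Finset (Fin n → Fin 3)) (w : Fin n → Fin 3)
    (τ : Equiv.Perm (Fin n)) : permFreq A (w ∘ τ) = permFreq A w := by
  unfold permFreq
  congr 1
  exact Equiv.sum_comp (Equiv.mulLeft τ) fun σ => if w ∘ σ ∈ A then (1 : ℚ) else 0

theorem sum_permFreq {n : ℕ} (A : Finset (Fin n → Fin 3)) :
    ∑ w, permFreq A w = A.card := by
  have hσ : ∀ σ : Equiv.Perm (Fin n),
      (∑ w : Fin n → Fin 3, if w ∘ σ ∈ A then (1 : ℚ) else 0) = A.card := fun σ => by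
    have := Equiv.sum_comp (Equiv.arrowCongr σ.symm (Equiv.refl (Fin 3)))
      fun w => if w ∈ A then (1 : ℚ) else 0
    have h2 : (∑ w : Fin n → Fin 3, if w ∈ A then (1 : ℚ) else 0) = A.card := by simp
    rw [← h2, ← this]
    rfl
  unfold permFreq
  rw [← sum_div, sum_comm, sum_congr rfl fun σ _ => hσ σ]
  have : (n.factorial : ℚ) ≠ 0 := by exact_mod_cast n.factorial_ne_zero
  simp [Fintype.card_perm]
  field_simp

theorem permFreq_middleLayers {n k : ℕ} (w : Fin n → Fin 3) :
    permFreq (middleLayers n k) w = if coordSum w ≡ n [MOD 2 * k + 1] then 1 else 0 := by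
  unfold permFreq
  simp only [mem_middleLayers, coordSum_comp_perm]
  have : (n.factorial : ℚ) ≠ 0 := by exact_mod_cast n.factorial_ne_zero
  split_ifs <;> simp [Fintype.card_perm, this]

theorem mem_of_permFreq_eq_one {n : ℕ} {A : Finset (Fin n → Fin 3)} {w : Fin n → Fin 3}
    (h : permFreq A w = 1) : w ∈ A := by
  have hf : (n.factorial : ℚ) ≠ 0 := by exact_mod_cast n.factorial_ne_zero
  unfold permFreq at h
  rw [div_eq_one_iff_eq hf] at h
  by_contra hw
  have hlt : (∑ σ : Equiv.Perm (Fin n), if w ∘ σ ∈ A then (1 : ℚ) else 0) <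
      ∑ _σ : Equiv.Perm (Fin n), (1 : ℚ) := by
    refine sum_lt_sum (fun σ _ => by split_ifs <;> norm_num) ⟨1, mem_univ _, ?_⟩
    rw [if_neg (by simpa using hw)]
    norm_num
  rw [h] at hlt
  simp [Fintype.card_perm] at hlt

open Classical in
/-- `permFreq A w` as a function of the numbers of zeros, ones and twos of `w`. -/
noncomputable def typeFreq {n : ℕ} (A : Finset (Fin n → Fin 3)) (a b c : ℕ) : ℚ :=
  if h : ∃ w : Fin n → Fin 3, valCount 0 w = a ∧ valCount 1 w = b ∧ valCount 2 w = c then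
    permFreq A h.choose else 0

theorem typeFreq_valCount {n : ℕ} (A : Finset (Fin n → Fin 3)) (w : Fin n → Fin 3) :
    typeFreq A (valCount 0 w) (valCount 1 w) (valCount 2 w) = permFreq A w := by
  have h : ∃ w' : Fin n → Fin 3, valCount 0 w' = valCount 0 w ∧ valCount 1 w' = valCount 1 w ∧
    valCount 2 w' = valCount 2 w := ⟨w, rfl, rfl, rfl⟩
  rw [typeFreq, dif_pos h]
  obtain ⟨h0, h1, h2⟩ := h.choose_spec
  obtain ⟨σ, hσ⟩ := exists_perm_comp_eq (w := h.choose) (w' := w) fun v => by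
    fin_cases v <;> assumption
  rw [← hσ, permFreq_comp_perm]

/-! ### Chain sums on types and the exchange identity. -/

/-- The sum of `f` over the types `(a + p, b, c + q)` with `p + q = j`. -/
def diagSum (f : ℕ → ℕ → ℕ → ℚ) (j a b c : ℕ) : ℚ :=
  ∑ p ∈ antidiagonal j, f (a + p.1) b (c + p.2)

/-- The sum of `f` over the types of a chain raising `j` coordinates one after another from `0` to
`2`, the other coordinates being fixed and of type `(a, b, c)`. -/
def chainSum (f : ℕ → ℕ → ℕ → ℚ) : ℕ → ℕ → ℕ → ℕ → ℚ
  | 0, a, b, c => diagSum f 0 a b c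
  | j + 1, a, b, c => diagSum f (j + 1) a b c + diagSum f j a (b + 1) c

/-- The sum of `chainSum f j` over all ways of adding `r` further fixed coordinates. -/
def extSum (f : ℕ → ℕ → ℕ → ℚ) : ℕ → ℕ → ℕ → ℕ → ℕ → ℚ
  | 0, j, a, b, c => chainSum f j a b c
  | r + 1, j, a, b, c =>
    extSum f r j (a + 1) b c + extSum f r j a (b + 1) c + extSum f r j a b (c + 1)

theorem diagSum_zero_exchange (f : ℕ → ℕ → ℕ → ℚ) (a b c : ℕ) :
    diagSum f 0 (a + 1) b c + diagSum f 0 a b (c + 1) = diagSum f 1 a b c := by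
  simp [diagSum, Finset.Nat.antidiagonal_succ]
  ring

/-- Each term on the left omits one end of the diagonal of length `j + 3`. Together they cover it
once and its interior twice, as the right side does. -/
theorem diagSum_succ_exchange (f : ℕ → ℕ → ℕ → ℚ) (j a b c : ℕ) :
    diagSum f (j + 1) (a + 1) b c + diagSum f (j + 1) a b (c + 1) =
      diagSum f (j + 2) a b c + diagSum f j (a + 1) b (c + 1) := by
  unfold diagSum
  rw [Finset.Nat.sum_antidiagonal_succ (n := j + 1)]
  rw [Finset.Nat.sum_antidiagonal_succ (n := j) (f := fun p => f (a + p.1) b (c + 1 + p.2))]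
  have e1 : ∀ x : ℕ × ℕ, f (a + (x.1 + 1)) b (c + 1 + x.2) = f (a + 1 + x.1) b (c + 1 + x.2) :=
    fun x => by rw [add_right_comm a 1, add_assoc a x.1 1]
  have e2 : ∀ x : ℕ × ℕ, f (a + (x.1 + 1)) b (c + x.2) = f (a + 1 + x.1) b (c + x.2) :=
    fun x => by rw [add_right_comm a 1, add_assoc a x.1 1]
  simp only [e1, e2, show c + 1 + (j + 1) = c + (j + 1 + 1) by ring]
  ring

theorem extSum_zero_right (f : ℕ → ℕ → ℕ → ℚ) (r a b c : ℕ) :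
    extSum f (r + 1) 0 a b c = extSum f r 1 a b c := by
  induction r generalizing a b c with
  | zero =>
    have := diagSum_zero_exchange f a b c
    simp only [extSum, chainSum]
    linarith
  | succ r ih =>
    rw [extSum, ih, ih, ih]
    rfl

/-- A chain times `{0 < 1 < 2}` splits into three chains: the free coordinate joins the raised ones,
is fixed at 1, or pairs with a raised one to leave a fixed 0 and a fixed 2. -/
theorem extSum_succ_right (f : ℕ → ℕ → ℕ → ℚ) (r j a b c : ℕ) :
    extSum f (r + 1) (j + 1) a b c = extSum f r (j + 2) a b c + extSum f r (j + 1) a (b + 1) c +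
      extSum f r j (a + 1) b (c + 1) := by
  induction r generalizing a b c with
  | zero =>
    have h1 := diagSum_succ_exchange f j a b c
    cases j with
    | zero =>
      have h2 := diagSum_zero_exchange f a (b + 1) c
      simp only [extSum, chainSum, zero_add] at *
      linarith
    | succ j =>
      have h2 := diagSum_succ_exchange f j a (b + 1) c
      simp only [extSum, chainSum] at *
      linarith
  | succ r ih =>
    have h0 := ih (a + 1) b c
    have h1 := ih a (b + 1) c
    have h2 := ih a b (c + 1)
    simp only [extSum] at h0 h1 h2 ⊢
    linarith

theorem valCount_cons {n : ℕ} (v u : Fin 3) (w : Fin n → Fin 3) :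
    valCount v (Fin.cons u w : Fin (n + 1) → Fin 3) =
      (if u = v then 1 else 0) + valCount v w := by
  unfold valCount
  rw [card_filter, card_filter, Fin.sum_univ_succ]
  simp

theorem sum_valCount_eq_extSum (f : ℕ → ℕ → ℕ → ℚ) (r a b c : ℕ) :
    ∑ w : Fin r → Fin 3, f (a + valCount 0 w) (b + valCount 1 w) (c + valCount 2 w) =
      extSum f r 0 a b c := by
  induction r generalizing a b c with
  | zero => simp [extSum, chainSum, diagSum, valCount]
  | succ r ih =>
    rw [← Equiv.sum_comp (Fin.consEquiv fun _ => Fin 3), Fintype.sum_prod_type,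
      Fin.sum_univ_three]
    have hc : ∀ (u : Fin 3) (w : Fin r → Fin 3),
        Fin.consEquiv (fun _ => Fin 3) (u, w) = Fin.cons u w := fun _ _ => rfl
    simp only [hc, valCount_cons]
    simp [← add_assoc, ih, extSum]

theorem card_eq_extSum {n : ℕ} (A : Finset (Fin n → Fin 3)) :
    (A.card : ℚ) = extSum (typeFreq A) n 0 0 0 0 := by
  rw [← sum_valCount_eq_extSum, ← sum_permFreq]
  simp [typeFreq_valCount]

theorem diagSum_sub (f g : ℕ → ℕ → ℕ → ℚ) (j a b c : ℕ) :
    diagSum (f - g) j a b c = diagSum f j a b c - diagSum g j a b c := by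
  simp [diagSum]

theorem chainSum_sub (f g : ℕ → ℕ → ℕ → ℚ) (j a b c : ℕ) :
    chainSum (f - g) j a b c = chainSum f j a b c - chainSum g j a b c := by
  cases j with
  | zero => simp only [chainSum, diagSum_sub]
  | succ j => simp only [chainSum, diagSum_sub]; ring

theorem extSum_sub (f g : ℕ → ℕ → ℕ → ℚ) (r j a b c : ℕ) :
    extSum (f - g) r j a b c = extSum f r j a b c - extSum g r j a b c := by
  induction r generalizing a b c with
  | zero => exact chainSum_sub f g j a b c
  | succ r ih => simp only [extSum, ih]; ring

/-! ### Nonnegativity of the total and its equality case. -/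

/-- `chainSum f` is nonnegative on full chains, and on shorter chains with balanced fixed part. -/
structure ChainNonneg (n k : ℕ) (f : ℕ → ℕ → ℕ → ℚ) : Prop where
  full : ∀ a b c, k + a + b + c = n → 0 ≤ chainSum f k a b c
  balanced : ∀ j a b, j < k → j + a + b + a = n → 0 ≤ chainSum f j a b a

theorem ChainNonneg.extSum_full {n k : ℕ} {f : ℕ → ℕ → ℕ → ℚ} (h : ChainNonneg n k f)
    {r a b c : ℕ} (hn : r + k + a + b + c = n) : 0 ≤ extSum f r k a b c := by
  induction r generalizing a b c with
  | zero => exact h.full a b c (by omega)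
  | succ r ih =>
    have h0 := @ih (a + 1) b c (by omega)
    have h1 := @ih a (b + 1) c (by omega)
    have h2 := @ih a b (c + 1) (by omega)
    rw [extSum]
    linarith

/-- The exchange identity preserves balance and increases `j` by at most one. It is applied only
below `k`; at `j = k` balance is no longer needed. -/
theorem ChainNonneg.extSum_balanced {n k : ℕ} {f : ℕ → ℕ → ℕ → ℚ} (h : ChainNonneg n k f)
    {r j a b : ℕ} (hj : j ≤ k) (hn : r + j + a + b + a = n) : 0 ≤ extSum f r j a b a := by
  induction r generalizing j a b with
  | zero =>
    rcases hj.lt_or_eq with hj | rfl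
    · exact h.balanced j a b hj (by omega)
    · exact h.full a b a (by omega)
  | succ r ih =>
    rcases hj.lt_or_eq with hj | rfl
    · cases j with
      | zero =>
        rw [extSum_zero_right]
        exact ih (by omega) (by omega)
      | succ j =>
        have h0 := @ih (j + 2) a b (by omega) (by omega)
        have h1 := @ih (j + 1) a (b + 1) (by omega) (by omega)
        have h2 := @ih j (a + 1) b (by omega) (by omega)
        rw [extSum_succ_right]
        linarith
    · exact h.extSum_full hn

theorem ChainNonneg.chainSum_full_eq_zero {n k : ℕ} {f : ℕ → ℕ → ℕ → ℚ} (h : ChainNonneg n k f)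
    {r a b c : ℕ} (hn : r + k + a + b + c = n) (h0 : extSum f r k a b c = 0) {a' b' c' : ℕ}
    (ha : a ≤ a') (hb : b ≤ b') (hc : c ≤ c') (hn' : k + a' + b' + c' = n) :
    chainSum f k a' b' c' = 0 := by
  induction r generalizing a b c with
  | zero =>
    obtain rfl : a = a' := by omega
    obtain rfl : b = b' := by omega
    obtain rfl : c = c' := by omega
    exact h0
  | succ r ih =>
    have p0 := h.extSum_full (r := r) (a := a + 1) (b := b) (c := c) (by omega)
    have p1 := h.extSum_full (r := r) (a := a) (b := b + 1) (c := c) (by omega)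
    have p2 := h.extSum_full (r := r) (a := a) (b := b) (c := c + 1) (by omega)
    rw [extSum] at h0
    rcases (show a < a' ∨ b < b' ∨ c < c' by omega) with hlt | hlt | hlt
    · exact ih (a := a + 1) (by omega) (by linarith) hlt hb hc
    · exact ih (b := b + 1) (by omega) (by linarith) ha hlt hc
    · exact ih (c := c + 1) (by omega) (by linarith) ha hb hlt

/-- Vanishing of `extSum` propagates along each of the three terms of its recursion. -/
theorem ChainNonneg.extSum_succ_eq_zero {n k : ℕ} {f : ℕ → ℕ → ℕ → ℚ} (h : ChainNonneg n k f)
    {r j a b : ℕ} (hj : j + 1 < k) (hn : r + 1 + (j + 1) + a + b + a = n)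
    (h0 : extSum f (r + 1) (j + 1) a b a = 0) :
    extSum f r (j + 2) a b a = 0 ∧ extSum f r (j + 1) a (b + 1) a = 0 ∧
      extSum f r j (a + 1) b (a + 1) = 0 := by
  have p0 := h.extSum_balanced (r := r) (j := j + 2) (a := a) (b := b) (by omega) (by omega)
  have p1 := h.extSum_balanced (r := r) (j := j + 1) (a := a) (b := b + 1) (by omega) (by omega)
  have p2 := h.extSum_balanced (r := r) (j := j) (a := a + 1) (b := b) (by omega) (by omega)
  rw [extSum_succ_right] at h0
  refine ⟨?_, ?_, ?_⟩ <;> linarith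

theorem ChainNonneg.extSum_full_eq_zero {n k : ℕ} {f : ℕ → ℕ → ℕ → ℚ} (h : ChainNonneg n k f)
    (h0 : extSum f n 0 0 0 0 = 0) {j r : ℕ} (hj : j ≤ k) (hn : r + j = n) :
    extSum f r j 0 0 0 = 0 := by
  induction j generalizing r with
  | zero => obtain rfl : r = n := by omega
            exact h0
  | succ j ih =>
    have := @ih (r + 1) (by omega) (by omega)
    cases j with
    | zero => rwa [extSum_zero_right] at this
    | succ j => exact (h.extSum_succ_eq_zero (by omega) (by omega) this).1

theorem ChainNonneg.extSum_one_eq_zero {n k : ℕ} {f : ℕ → ℕ → ℕ → ℚ} (h : ChainNonneg n k f)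
    (hk : 2 ≤ k) (h0 : extSum f n 0 0 0 0 = 0) {b r : ℕ} (hn : r + 1 + b = n) :
    extSum f r 1 0 b 0 = 0 := by
  induction b generalizing r with
  | zero => exact h.extSum_full_eq_zero h0 (by omega) (by omega)
  | succ b ih =>
    exact (h.extSum_succ_eq_zero (by omega) (by omega) (@ih (r + 1) (by omega))).2.1

/-- Balanced points arise by dropping from `j = 1` to `j = 0`. That exchange step is available only
for `k ≥ 2`. -/
theorem ChainNonneg.extSum_zero_eq_zero {n k : ℕ} {f : ℕ → ℕ → ℕ → ℚ} (h : ChainNonneg n k f)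
    (hk : 2 ≤ k) (h0 : extSum f n 0 0 0 0 = 0) {a b r : ℕ}
    (hn : r + (a + 1) + b + (a + 1) = n) : extSum f r 0 (a + 1) b (a + 1) = 0 := by
  induction a generalizing r with
  | zero =>
    have := h.extSum_one_eq_zero hk h0 (b := b) (r := r + 1) (by omega)
    exact (h.extSum_succ_eq_zero (by omega) (by omega) this).2.2
  | succ a ih =>
    have := @ih (r + 2) (by omega)
    rw [extSum_zero_right] at this
    exact (h.extSum_succ_eq_zero (by omega) (by omega) this).2.2

/-! ### Explicit chains of words. -/

/-- Each of the first `j` coordinates is raised from `0` to `2` before the next one, `s` steps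
being made in total; the other coordinates are `a` zeros, `b` ones and then twos. -/
def chainWord (n j a b s : ℕ) : Fin n → Fin 3 := fun l =>
  if (l : ℕ) < j then ⟨min 2 (s - 2 * l), by omega⟩
  else if (l : ℕ) < j + a then 0 else if (l : ℕ) < j + a + b then 1 else 2

theorem chainWord_mono {n j a b s t : ℕ} (h : s ≤ t) (l : Fin n) :
    chainWord n j a b s l ≤ chainWord n j a b t l := by
  unfold chainWord
  split_ifs
  · rw [Fin.mk_le_mk]; omega
  all_goals exact le_rfl

theorem card_chainWord_lt {n j a b s t : ℕ} (σ : Equiv.Perm (Fin n)) :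
    (univ.filter fun l : Fin n =>
      (chainWord n j a b s ∘ σ) l < (chainWord n j a b t ∘ σ) l).card ≤ j := by
  have hsub : ((univ.filter fun l : Fin n =>
      (chainWord n j a b s ∘ σ) l < (chainWord n j a b t ∘ σ) l).image fun l => (σ l : ℕ)) ⊆
        range j := by
    intro m hm
    simp only [mem_image, mem_filter, mem_univ, true_and, Function.comp_apply] at hm
    obtain ⟨l, hl, rfl⟩ := hm
    rw [mem_range]
    by_contra hj
    simp [chainWord, hj] at hl
  have := card_le_card hsub
  have hinj : Function.Injective fun l : Fin n => (σ l : ℕ) :=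
    Fin.val_injective.comp σ.injective
  rwa [card_image_of_injective _ hinj, card_range] at this

theorem chainWord_ne {n j a b s t : ℕ} (hj : j ≤ n) (hst : s < t) (ht : t ≤ 2 * j) :
    chainWord n j a b s ≠ chainWord n j a b t := by
  intro h
  have h1 := congrFun h ⟨s / 2, by omega⟩
  have h2 : s / 2 < j := by omega
  simp only [chainWord, h2, if_true, Fin.mk.injEq] at h1
  omega

theorem card_filter_fin_val {n : ℕ} (p : Fin n → Prop) [DecidablePred p] (T : Finset ℕ)
    (h : ∀ m, m ∈ T ↔ ∃ hm : m < n, p ⟨m, hm⟩) : (univ.filter p).card = T.card := by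
  rw [← card_image_of_injective _ Fin.val_injective]
  congr 1
  ext m
  rw [h]
  simp only [mem_image, mem_filter, mem_univ, true_and]
  exact ⟨fun ⟨l, hl, e⟩ => e ▸ ⟨l.2, hl⟩, fun ⟨hm, hp⟩ => ⟨⟨m, hm⟩, hp, rfl⟩⟩

theorem valCount_one_chainWord {n j a b c s : ℕ} (hn : j + a + b + c = n) (hs : s ≤ 2 * j) :
    valCount 1 (chainWord n j a b s) = b + s % 2 := by
  unfold valCount
  -- The first interval is the half-raised coordinate, present only for odd `s`.
  rw [card_filter_fin_val _ (Ico (s / 2) (s / 2 + s % 2) ∪ Ico (j + a) (j + a + b)),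
    card_union_of_disjoint]
  · simp; omega
  · rw [disjoint_left]; intro m; simp only [mem_Ico]; omega
  · intro m
    simp only [mem_union, mem_Ico, chainWord]
    constructor
    · intro h
      refine ⟨by omega, ?_⟩
      split_ifs <;> first | omega | rfl | (rw [Fin.ext_iff]; simp; omega)
    · rintro ⟨hm, h⟩
      split_ifs at h <;> simp [Fin.ext_iff] at h <;> omega

theorem valCount_two_chainWord {n j a b c s : ℕ} (hn : j + a + b + c = n) (hs : s ≤ 2 * j) :
    valCount 2 (chainWord n j a b s) = c + s / 2 := by
  unfold valCount
  rw [card_filter_fin_val _ (range (s / 2) ∪ Ico (j + a + b) n), card_union_of_disjoint]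
  · simp; omega
  · rw [disjoint_left]; intro m; simp only [mem_Ico, mem_range]; omega
  · intro m
    simp only [mem_union, mem_Ico, mem_range, chainWord]
    constructor
    · intro h
      refine ⟨by omega, ?_⟩
      split_ifs <;> first | omega | rfl | (rw [Fin.ext_iff]; simp; omega)
    · rintro ⟨hm, h⟩
      split_ifs at h <;> simp [Fin.ext_iff] at h <;> omega

theorem valCount_zero_chainWord {n j a b c s : ℕ} (hn : j + a + b + c = n) (hs : s ≤ 2 * j) :
    valCount 0 (chainWord n j a b s) = a + (j - s / 2 - s % 2) := by
  have h0 := sum_valCount (chainWord n j a b s)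
  rw [valCount_one_chainWord hn hs, valCount_two_chainWord hn hs] at h0
  omega

theorem coordSum_chainWord {n j a b c s : ℕ} (hn : j + a + b + c = n) (hs : s ≤ 2 * j) :
    coordSum (chainWord n j a b s) = b + 2 * c + s := by
  rw [coordSum_eq_valCount, valCount_one_chainWord hn hs, valCount_two_chainWord hn hs]
  omega

theorem sum_range_two_mul_add_one (g : ℕ → ℚ) (j : ℕ) :
    ∑ s ∈ range (2 * j + 1), g s =
      ∑ i ∈ range (j + 1), g (2 * i) + ∑ i ∈ range j, g (2 * i + 1) := by
  induction j with
  | zero => simp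
  | succ j ih =>
    rw [show 2 * (j + 1) + 1 = 2 * j + 1 + 1 + 1 by ring, sum_range_succ, sum_range_succ, ih,
      sum_range_succ _ (j + 1), sum_range_succ _ j, sum_range_succ (fun i => g (2 * i + 1)) j]
    ring_nf

theorem diagSum_eq_sum_range (f : ℕ → ℕ → ℕ → ℚ) (j a b c : ℕ) :
    diagSum f j a b c = ∑ i ∈ range (j + 1), f (a + (j - i)) b (c + i) := by
  unfold diagSum
  rw [← Finset.Nat.sum_antidiagonal_swap]
  exact Finset.Nat.sum_antidiagonal_eq_sum_range_succ_mk (fun p => f (a + p.2) b (c + p.1)) j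

theorem chainSum_typeFreq {n : ℕ} (A : Finset (Fin n → Fin 3)) {j a b c : ℕ}
    (hn : j + a + b + c = n) :
    chainSum (typeFreq A) j a b c =
      ∑ s ∈ range (2 * j + 1), permFreq A (chainWord n j a b s) := by
  have h : ∀ s ∈ range (2 * j + 1), permFreq A (chainWord n j a b s) =
      typeFreq A (a + (j - s / 2 - s % 2)) (b + s % 2) (c + s / 2) := fun s hs => by
    have hs : s ≤ 2 * j := by rw [mem_range] at hs; omega
    rw [← typeFreq_valCount, valCount_zero_chainWord hn hs, valCount_one_chainWord hn hs,
      valCount_two_chainWord hn hs]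
  rw [sum_congr rfl h, sum_range_two_mul_add_one]
  have e1 : ∀ i, 2 * i / 2 = i := fun i => by omega
  have e2 : ∀ i, (2 * i + 1) / 2 = i := fun i => by omega
  have e3 : ∀ i, 2 * i % 2 = 0 := fun i => by omega
  have e4 : ∀ i, (2 * i + 1) % 2 = 1 := fun i => by omega
  simp only [e1, e2, e3, e4]
  cases j with
  | zero => simp [chainSum, diagSum]
  | succ j =>
    simp only [chainSum, diagSum_eq_sum_range, add_zero, Nat.sub_zero]
    congr 1
    refine sum_congr rfl fun i _ => ?_
    rw [show j + 1 - i - 1 = j - i by omega]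

theorem sum_permFreq_chainWord {n : ℕ} (A : Finset (Fin n → Fin 3)) (j a b : ℕ) :
    ∑ s ∈ range (2 * j + 1), permFreq A (chainWord n j a b s) =
      (∑ σ : Equiv.Perm (Fin n),
        (((range (2 * j + 1)).filter fun s => chainWord n j a b s ∘ σ ∈ A).card : ℚ)) /
          (n.factorial : ℚ) := by
  unfold permFreq
  rw [← sum_div, sum_comm]
  simp

/-! ### Chains against admissible sets and middle layers; the bound. -/

theorem Admissible.eq_of_chainWord_mem {n k : ℕ} {A : Finset (Fin n → Fin 3)}
    (hA : Admissible k A) {j a b s t : ℕ} (hjk : j ≤ k) (hjn : j ≤ n) (hs : s ≤ 2 * j)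
    (ht : t ≤ 2 * j) {σ : Equiv.Perm (Fin n)} (hsA : chainWord n j a b s ∘ σ ∈ A)
    (htA : chainWord n j a b t ∘ σ ∈ A) : s = t := by
  wlog hst : s < t generalizing s t
  · rcases lt_trichotomy s t with h | h | h
    · exact this hs ht hsA htA h
    · exact h
    · exact (this ht hs htA hsA h).symm
  refine (hA ⟨_, hsA, _, htA, fun h => ?_, fun l => chainWord_mono hst.le _,
    (card_chainWord_lt σ).trans hjk⟩).elim
  exact chainWord_ne hjn hst ht (σ.surjective.injective_comp_right h)

theorem Admissible.card_chainWord_mem_le {n k : ℕ} {A : Finset (Fin n → Fin 3)}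
    (hA : Admissible k A) {j a b : ℕ} (hjk : j ≤ k) (hjn : j ≤ n) (σ : Equiv.Perm (Fin n)) :
    ((range (2 * j + 1)).filter fun s => chainWord n j a b s ∘ σ ∈ A).card ≤ 1 := by
  rw [card_le_one]
  intro s hs t ht
  rw [mem_filter, mem_range] at hs ht
  exact hA.eq_of_chainWord_mem hjk hjn (by omega) (by omega) hs.2 ht.2

theorem Admissible.chainSum_le {n k : ℕ} {A : Finset (Fin n → Fin 3)} (hA : Admissible k A)
    {j a b c : ℕ} (hjk : j ≤ k) (hn : j + a + b + c = n) :
    chainSum (typeFreq A) j a b c ≤ 1 := by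
  rw [chainSum_typeFreq A hn, sum_permFreq_chainWord,
    div_le_one (by exact_mod_cast n.factorial_pos)]
  calc _ ≤ ∑ _σ : Equiv.Perm (Fin n), (1 : ℚ) := sum_le_sum fun σ _ => by
        exact_mod_cast hA.card_chainWord_mem_le hjk (by omega) σ
    _ = _ := by simp [Fintype.card_perm]

theorem Admissible.exists_chainWord_mem {n k : ℕ} {A : Finset (Fin n → Fin 3)}
    (hA : Admissible k A) {j a b c : ℕ} (hjk : j ≤ k) (hn : j + a + b + c = n)
    (h : chainSum (typeFreq A) j a b c = 1) (σ : Equiv.Perm (Fin n)) :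
    ∃ s ≤ 2 * j, chainWord n j a b s ∘ σ ∈ A := by
  by_contra! hσ
  have hf : (n.factorial : ℚ) ≠ 0 := by exact_mod_cast n.factorial_ne_zero
  rw [chainSum_typeFreq A hn, sum_permFreq_chainWord, div_eq_one_iff_eq hf] at h
  have hlt : ∑ σ : Equiv.Perm (Fin n),
      (((range (2 * j + 1)).filter fun s => chainWord n j a b s ∘ σ ∈ A).card : ℚ) <
        ∑ _σ : Equiv.Perm (Fin n), (1 : ℚ) := by
    refine sum_lt_sum (fun τ _ => ?_) ⟨σ, mem_univ _, ?_⟩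
    · exact_mod_cast hA.card_chainWord_mem_le hjk (by omega) τ
    · rw [filter_eq_empty_iff.2 fun s hs => hσ s (by rw [mem_range] at hs; omega)]
      simp
  rw [h] at hlt
  simp [Fintype.card_perm] at hlt

theorem chainSum_middleLayers {n k j a b c s : ℕ} (hn : j + a + b + c = n) (hjk : j ≤ k)
    (hs : s ≤ 2 * j) (h : b + 2 * c + s ≡ n [MOD 2 * k + 1]) :
    chainSum (typeFreq (middleLayers n k)) j a b c = 1 := by
  rw [chainSum_typeFreq _ hn, sum_eq_single_of_mem s (mem_range.2 (by omega))]
  · rw [permFreq_middleLayers, coordSum_chainWord hn hs, if_pos h]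
  · intro t ht hts
    rw [mem_range] at ht
    rw [permFreq_middleLayers, coordSum_chainWord hn (by omega), if_neg]
    intro h'
    exact hts ((Nat.ModEq.add_left_cancel' _ (h'.trans h.symm)).eq_of_lt_of_lt
      (by omega) (by omega))

theorem chainSum_middleLayers_full {n k a b c : ℕ} (hn : k + a + b + c = n) :
    chainSum (typeFreq (middleLayers n k)) k a b c = 1 := by
  -- The step that hits `B` is the residue of `n - (b + 2c)`; the added multiple of `2k + 1` keeps
  -- the natural subtraction from truncating.
  have h1 : (n + (2 * k + 1) * (b + 2 * c) - (b + 2 * c)) % (2 * k + 1) < 2 * k + 1 :=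
    Nat.mod_lt _ (by omega)
  refine chainSum_middleLayers hn le_rfl (Nat.lt_succ_iff.1 h1) ?_
  have h2 : b + 2 * c ≤ (2 * k + 1) * (b + 2 * c) := Nat.le_mul_of_pos_left _ (by omega)
  calc b + 2 * c + (n + (2 * k + 1) * (b + 2 * c) - (b + 2 * c)) % (2 * k + 1)
      ≡ b + 2 * c + (n + (2 * k + 1) * (b + 2 * c) - (b + 2 * c)) [MOD 2 * k + 1] :=
        Nat.ModEq.add_left _ (Nat.mod_modEq _ _)
    _ = n + (2 * k + 1) * (b + 2 * c) := by omega
    _ ≡ n [MOD 2 * k + 1] := by simp [Nat.ModEq]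

theorem chainSum_middleLayers_balanced {n k j a b : ℕ} (hjk : j ≤ k) (hn : j + a + b + a = n) :
    chainSum (typeFreq (middleLayers n k)) j a b a = 1 :=
  chainSum_middleLayers (s := j) hn hjk (by omega)
    (by rw [show b + 2 * a + j = n by omega])

theorem Admissible.chainNonneg {n k : ℕ} {A : Finset (Fin n → Fin 3)} (hA : Admissible k A) :
    ChainNonneg n k (typeFreq (middleLayers n k) - typeFreq A) where
  full a b c hn := by
    rw [chainSum_sub, chainSum_middleLayers_full hn, sub_nonneg]
    exact hA.chainSum_le le_rfl hn
  balanced j a b hj hn := by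
    rw [chainSum_sub, chainSum_middleLayers_balanced hj.le hn, sub_nonneg]
    exact hA.chainSum_le hj.le hn

theorem extSum_sub_eq_card_sub {n k : ℕ} (A : Finset (Fin n → Fin 3)) :
    extSum (typeFreq (middleLayers n k) - typeFreq A) n 0 0 0 0 =
      (middleLayers n k).card - A.card := by
  rw [extSum_sub, card_eq_extSum, card_eq_extSum]

theorem Admissible.card_le {n k : ℕ} {A : Finset (Fin n → Fin 3)} (hA : Admissible k A) :
    A.card ≤ (middleLayers n k).card := by
  have := hA.chainNonneg.extSum_balanced (r := n) (j := 0) (a := 0) (b := 0) (by omega) (by omega)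
  rw [extSum_sub_eq_card_sub, sub_nonneg] at this
  exact_mod_cast this

/-! ### Admissibility of the middle layers. -/

theorem coordSum_le_add {n : ℕ} {x y : Fin n → Fin 3} (hxy : ∀ i, x i ≤ y i) :
    coordSum y ≤ coordSum x + 2 * (univ.filter fun i => x i < y i).card := by
  unfold coordSum
  rw [card_filter, mul_sum, ← sum_add_distrib]
  refine sum_le_sum fun i _ => ?_
  have := hxy i
  have h2 := (y i).2
  split_ifs with h
  · omega
  · rw [Fin.lt_def] at h; omega

theorem coordSum_lt {n : ℕ} {x y : Fin n → Fin 3} (hxy : ∀ i, x i ≤ y i) (hne : x ≠ y) :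
    coordSum x < coordSum y := by
  obtain ⟨i, hi⟩ := Function.ne_iff.1 hne
  exact sum_lt_sum (fun i _ => hxy i) ⟨i, mem_univ i, lt_of_le_of_ne (hxy i) (by
    simpa [Fin.ext_iff] using hi)⟩

theorem admissible_middleLayers (n k : ℕ) : Admissible k (middleLayers n k) := by
  rintro ⟨x, hx, y, hy, hne, hxy, hk⟩
  rw [mem_middleLayers] at hx hy
  have h1 := coordSum_le_add hxy
  have h2 := coordSum_lt hxy hne
  have h3 := (Nat.modEq_iff_dvd' h2.le).1 (hx.trans hy.symm)
  have := Nat.le_of_dvd (by omega) h3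
  omega

/-! ### Uniqueness: the levels from `n` upwards. -/

theorem exists_perm_chainWord {n j a b c s : ℕ} (hn : j + a + b + c = n) (hs : s ≤ 2 * j)
    {x : Fin n → Fin 3} (h1 : valCount 1 x = b + s % 2) (h2 : valCount 2 x = c + s / 2) :
    ∃ σ : Equiv.Perm (Fin n), chainWord n j a b s ∘ σ = x := by
  refine exists_perm_comp_eq fun v => ?_
  have hx := sum_valCount x
  have e1 := valCount_one_chainWord hn hs
  have e2 := valCount_two_chainWord hn hs
  have hw := sum_valCount (chainWord n j a b s)
  fin_cases v
  · change valCount 0 x = valCount 0 (chainWord n j a b s)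
    omega
  · exact h1.trans e1.symm
  · exact h2.trans e2.symm

theorem coordSum_add_valCount_zero {n : ℕ} (x : Fin n → Fin 3) :
    coordSum x + valCount 0 x = n + valCount 2 x := by
  have h1 := coordSum_eq_valCount x
  have h2 := sum_valCount x
  omega

theorem exists_lower {n k s : ℕ} {y : Fin n → Fin 3} (hs0 : 1 ≤ s) (hsk : s ≤ 2 * k)
    (hs : s ≤ valCount 2 y) : ∃ x : Fin n → Fin 3, coordSum x + s = coordSum y ∧ x ≠ y ∧
      (∀ i, x i ≤ y i) ∧ (univ.filter fun i => x i < y i).card ≤ k := by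
  -- Lowering `j` twos can absorb up to `2j` units, and `min s k` is enough for `s ≤ 2k`.
  obtain ⟨j, hj⟩ : ∃ j, j = min s k := ⟨_, rfl⟩
  have hy := sum_valCount y
  obtain ⟨a, ha⟩ : ∃ a, valCount 0 y = a := ⟨_, rfl⟩
  obtain ⟨b, hb⟩ : ∃ b, valCount 1 y = b := ⟨_, rfl⟩
  obtain ⟨c, hc⟩ : ∃ c, valCount 2 y = j + c := ⟨valCount 2 y - j, by omega⟩
  have hn : j + a + b + c = n := by omega
  obtain ⟨σ, rfl⟩ := exists_perm_chainWord (s := 2 * j) (x := y) hn le_rfl (by omega) (by omega)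
  have hsum : coordSum (chainWord n j a b (2 * j - s) ∘ σ) + s =
      coordSum (chainWord n j a b (2 * j) ∘ σ) := by
    rw [coordSum_comp_perm, coordSum_comp_perm, coordSum_chainWord hn (by omega),
      coordSum_chainWord hn le_rfl]
    omega
  refine ⟨chainWord n j a b (2 * j - s) ∘ σ, hsum, fun h => ?_,
    fun l => chainWord_mono (by omega) _, (card_chainWord_lt σ).trans (by omega)⟩
  rw [h] at hsum
  omega

theorem coordSum_update {n : ℕ} (w : Fin n → Fin 3) (i : Fin n) (v : Fin 3) :
    coordSum (Function.update w i v) + w i = coordSum w + v := by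
  unfold coordSum
  rw [← add_sum_erase univ (fun l => (w l : ℕ)) (mem_univ i),
    ← add_sum_erase univ (fun l => (Function.update w i v l : ℕ)) (mem_univ i),
    Function.update_self, sum_congr rfl fun l hl => by
      rw [Function.update_of_ne (ne_of_mem_erase hl)]]
  ring

/-- An admissible set meeting in exactly one point, on average over all permutations of the
coordinates, every chain that is used to bound its size. -/
structure ChainTight (n k : ℕ) (A : Finset (Fin n → Fin 3)) : Prop where
  admissible : Admissible k A
  full : ∀ a b c, k + a + b + c = n → chainSum (typeFreq A) k a b c = 1
  single : ∀ b, 1 + b = n → chainSum (typeFreq A) 1 0 b 0 = 1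
  point : ∀ a b, a + 1 + b + (a + 1) = n → chainSum (typeFreq A) 0 (a + 1) b (a + 1) = 1

theorem Admissible.chainTight {n k : ℕ} {A : Finset (Fin n → Fin 3)} (hA : Admissible k A)
    (hk : 2 ≤ k) (hkn : k ≤ n) (hcard : A.card = (middleLayers n k).card) :
    ChainTight n k A := by
  have h := hA.chainNonneg
  have h0 := extSum_sub_eq_card_sub (k := k) A
  rw [hcard, sub_self] at h0
  refine ⟨hA, fun a b c hn => ?_, fun b hn => ?_, fun a b hn => ?_⟩
  · have := h.chainSum_full_eq_zero (r := n - k) (by omega)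
      (h.extSum_full_eq_zero h0 le_rfl (by omega)) (Nat.zero_le a) (Nat.zero_le b) (Nat.zero_le c) hn
    rw [chainSum_sub, chainSum_middleLayers_full hn] at this
    linarith
  · have := h.extSum_one_eq_zero hk h0 (b := b) (r := 0) (by omega)
    rw [extSum, chainSum_sub, chainSum_middleLayers_balanced (by omega) (by omega)] at this
    linarith
  · have := h.extSum_zero_eq_zero hk h0 (a := a) (b := b) (r := 0) (by omega)
    rw [extSum, chainSum_sub, chainSum_middleLayers_balanced (by omega) (by omega)] at this
    linarith

theorem ChainTight.mem_of_exists_zero {n k : ℕ} {A : Finset (Fin n → Fin 3)}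
    (h : ChainTight n k A) {x : Fin n → Fin 3} (hx : coordSum x = n) {i : Fin n}
    (hi : x i = 0 ∨ x i = 2) : x ∈ A := by
  have h1 := coordSum_add_valCount_zero x
  have h2 := sum_valCount x
  have h3 : 0 < valCount 0 x := by
    rcases hi with hi | hi
    · exact card_pos.2 ⟨i, by simp [hi]⟩
    · have : 0 < valCount 2 x := card_pos.2 ⟨i, by simp [hi]⟩
      omega
  obtain ⟨a, ha⟩ : ∃ a, valCount 0 x = a + 1 := ⟨valCount 0 x - 1, by omega⟩
  have := h.point a (valCount 1 x) (by omega)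
  refine mem_of_permFreq_eq_one ?_
  rw [← typeFreq_valCount, ha, show valCount 2 x = a + 1 by omega]
  simpa [chainSum, diagSum] using this

/-- Tight points give every word of level `n` except the all-ones word. That word is the middle of a
tight chain with one raised coordinate, and each end of the chain conflicts with a word of level `n`
already in `A`. -/
theorem ChainTight.mem_of_coordSum_eq {n k : ℕ} {A : Finset (Fin n → Fin 3)}
    (h : ChainTight n k A) (hk : 1 ≤ k) (hn : 2 ≤ n) {x : Fin n → Fin 3}
    (hx : coordSum x = n) : x ∈ A := by
  by_cases hex : ∃ i, x i = 0 ∨ x i = 2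
  · obtain ⟨i, hi⟩ := hex
    exact h.mem_of_exists_zero hx hi
  push Not at hex
  have h0 : valCount 0 x = 0 := card_eq_zero.2 (filter_eq_empty_iff.2 fun i _ => (hex i).1)
  have h2 : valCount 2 x = 0 := card_eq_zero.2 (filter_eq_empty_iff.2 fun i _ => (hex i).2)
  have hsum := sum_valCount x
  obtain ⟨b, hb⟩ : ∃ b, 1 + b = n := ⟨n - 1, by omega⟩
  have hb' : 1 + 0 + b + 0 = n := by omega
  obtain ⟨σ, rfl⟩ := exists_perm_chainWord (s := 1) (x := x) hb' (by omega)
    (by omega) (by omega)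
  obtain ⟨s, hs, hsA⟩ := h.admissible.exists_chainWord_mem hk hb' (h.single b hb) σ
  by_contra hxA
  have hs1 : s ≠ 1 := by rintro rfl; exact hxA hsA
  have hw : coordSum (chainWord n 1 0 b s ∘ σ) = b + s := by
    rw [coordSum_comp_perm, coordSum_chainWord hb' hs]
    omega
  have hpos : 0 < valCount 1 (chainWord n 1 0 b s ∘ σ) := by
    rw [valCount_comp_perm, valCount_one_chainWord hb' hs]
    omega
  obtain ⟨i, hi⟩ := card_pos.1 hpos
  generalize chainWord n 1 0 b s ∘ σ = w at *
  rw [mem_filter] at hi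
  have hval : ((w i : Fin 3) : ℕ) = 1 := by rw [hi.2]; rfl
  have hcard : ∀ (v : Fin 3) (p : Fin n → Prop) [DecidablePred p],
      (∀ l, p l → Function.update w i v l ≠ w l) → (univ.filter p).card ≤ k := by
    intro v p _ hp
    refine le_trans (card_le_card (t := {i}) fun l hl => ?_) ((card_singleton i).le.trans hk)
    rw [mem_filter] at hl
    rw [mem_singleton]
    by_contra hli
    exact hp l hl.2 (Function.update_of_ne hli _ _)
  rcases (show s = 0 ∨ s = 2 by omega) with rfl | rfl
  -- Here `w` has level `n - 1`, so raising a 1 to 2 reaches level `n` at a word containing a 2.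
  · have hu := coordSum_update w i 2
    rw [hval] at hu
    have huA := h.mem_of_exists_zero (x := Function.update w i 2) (i := i)
      (by change _ + 1 = _ + 2 at hu; omega) (Or.inr (Function.update_self ..))
    refine h.admissible ⟨w, hsA, _, huA, fun he => ?_, fun l => ?_, hcard 2 _ fun l hl => hl.ne'⟩
    · have := congrFun he i
      rw [Function.update_self, hi.2] at this
      exact absurd this (by decide)
    · by_cases hl : l = i
      · subst hl; rw [Function.update_self, hi.2]; decide
      · rw [Function.update_of_ne hl]
  · have hu := coordSum_update w i 0
    rw [hval] at hu
    have huA := h.mem_of_exists_zero (x := Function.update w i 0) (i := i)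
      (by change _ + 1 = _ + 0 at hu; omega) (Or.inl (Function.update_self ..))
    refine h.admissible ⟨_, huA, w, hsA, fun he => ?_, fun l => ?_, hcard 0 _ fun l hl => hl.ne⟩
    · have := congrFun he i
      rw [Function.update_self, hi.2] at this
      exact absurd this (by decide)
    · by_cases hl : l = i
      · subst hl; rw [Function.update_self]; exact Fin.zero_le _
      · rw [Function.update_of_ne hl]

/-- A tight full chain with top `x` meets `A`. A meeting point below `x` would lie at most `2k`
levels above the previous layer, and `exists_lower` would yield a forbidden pair. -/
theorem ChainTight.mem_of_coordSum_eq_add {n k : ℕ} {A : Finset (Fin n → Fin 3)}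
    (h : ChainTight n k A) (hk : 1 ≤ k) (hn : 2 ≤ n) (t : ℕ) {x : Fin n → Fin 3}
    (hx : coordSum x = n + (2 * k + 1) * t) : x ∈ A := by
  induction t generalizing x with
  | zero => exact h.mem_of_coordSum_eq hk hn (by omega)
  | succ t ih =>
    rw [mul_add, mul_one] at hx
    have h1 := coordSum_add_valCount_zero x
    have h2 := sum_valCount x
    obtain ⟨a, ha⟩ : ∃ a, valCount 0 x = a := ⟨_, rfl⟩
    obtain ⟨b, hb⟩ : ∃ b, valCount 1 x = b := ⟨_, rfl⟩
    -- The level of `x` exceeds `n` by at least `2k + 1`, so `x` has more than `k` twos.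
    obtain ⟨c, hc⟩ : ∃ c, valCount 2 x = k + c := ⟨valCount 2 x - k, by omega⟩
    have hxn : k + a + b + c = n := by omega
    obtain ⟨σ, rfl⟩ := exists_perm_chainWord (s := 2 * k) (x := x) hxn le_rfl (by omega) (by omega)
    obtain ⟨s, hs, hsA⟩ := h.admissible.exists_chainWord_mem le_rfl hxn (h.full _ _ _ hxn) σ
    rcases hs.lt_or_eq with hlt | rfl
    · exfalso
      rw [coordSum_comp_perm, coordSum_chainWord hxn le_rfl] at hx
      have hy : coordSum (chainWord n k a b s ∘ σ) = n + (2 * k + 1) * t + (s + 1) := by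
        rw [coordSum_comp_perm, coordSum_chainWord hxn hs]
        omega
      have hy2 := coordSum_add_valCount_zero (chainWord n k a b s ∘ σ)
      obtain ⟨y, hyS, hne, hle, hyk⟩ := exists_lower (k := k) (s := s + 1)
        (y := chainWord n k a b s ∘ σ) (by omega) (by omega) (by omega)
      exact h.admissible ⟨y, ih (by omega), _, hsA, hne, hle, hyk⟩
    · exact hsA

/-! ### Reflection for the levels below `n`, and the conclusion. -/

theorem coordSum_rev {n : ℕ} (x : Fin n → Fin 3) :
    coordSum (Fin.rev ∘ x) + coordSum x = 2 * n := by
  unfold coordSum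
  rw [← sum_add_distrib, sum_congr rfl (g := fun _ => 2) fun i _ => by
    rw [Function.comp_apply, Fin.val_rev]; omega]
  simp [mul_comm]

theorem admissible_rev {n k : ℕ} {A : Finset (Fin n → Fin 3)} (hA : Admissible k A) :
    Admissible k (univ.filter fun x : Fin n → Fin 3 => Fin.rev ∘ x ∈ A) := by
  rintro ⟨x, hx, y, hy, hne, hxy, hk⟩
  rw [mem_filter] at hx hy
  refine hA ⟨_, hy.2, _, hx.2, fun h => hne ?_, fun i => Fin.rev_le_rev.2 (hxy i), ?_⟩
  · exact (Fin.rev_injective.comp_left h).symm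
  · simpa only [Function.comp_apply, Fin.rev_lt_rev] using hk

theorem card_rev {n : ℕ} (A : Finset (Fin n → Fin 3)) :
    (univ.filter fun x : Fin n → Fin 3 => Fin.rev ∘ x ∈ A).card = A.card := by
  refine card_equiv (Equiv.arrowCongr (Equiv.refl (Fin n)) Fin.revPerm) fun x => ?_
  rw [mem_filter]
  exact and_iff_right (mem_univ x)

theorem Admissible.mem_of_le_coordSum {n k : ℕ} {A : Finset (Fin n → Fin 3)}
    (hA : Admissible k A) (hk : 2 ≤ k) (hkn : k ≤ n)
    (hcard : A.card = (middleLayers n k).card) {x : Fin n → Fin 3}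
    (hx : x ∈ middleLayers n k) (hxn : n ≤ coordSum x) : x ∈ A := by
  rw [mem_middleLayers] at hx
  obtain ⟨t, ht⟩ := (Nat.modEq_iff_dvd' hxn).1 hx.symm
  exact (hA.chainTight hk hkn hcard).mem_of_coordSum_eq_add (by omega) (by omega) t (by omega)

theorem Admissible.eq_middleLayers {n k : ℕ} {A : Finset (Fin n → Fin 3)}
    (hA : Admissible k A) (hk : 2 ≤ k) (hkn : k ≤ n)
    (hcard : A.card = (middleLayers n k).card) : A = middleLayers n k := by
  refine (eq_of_subset_of_card_le (fun x hx => ?_) hcard.le).symm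
  rcases le_total n (coordSum x) with hxn | hxn
  · exact hA.mem_of_le_coordSum hk hkn hcard hx hxn
  have hr := coordSum_rev x
  have hrev : Fin.rev ∘ x ∈ middleLayers n k := by
    rw [mem_middleLayers] at hx ⊢
    have hd := (Nat.modEq_iff_dvd' hxn).1 hx
    refine ((Nat.modEq_iff_dvd' (by omega)).2 ?_).symm
    rwa [show coordSum (Fin.rev ∘ x) - n = n - coordSum x by omega]
  have := (admissible_rev hA).mem_of_le_coordSum hk hkn ((card_rev A).trans hcard) hrev
    (by omega)
  rw [mem_filter] at this
  have hrr : Fin.rev ∘ Fin.rev ∘ x = x := by funext i; simp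
  rw [hrr] at this
  exact this.2

theorem theorem1 (n k : ℕ) (hk : k ≤ n) :
    Admissible k (middleLayers n k) ∧
    (∀ A : Finset (Fin n → Fin 3), Admissible k A → A.card ≤ (middleLayers n k).card) ∧
    (k ≠ 1 → ∀ A : Finset (Fin n → Fin 3), Admissible k A →
      A.card = (middleLayers n k).card → A = middleLayers n k) := by
  refine ⟨admissible_middleLayers n k, fun A hA => hA.card_le, fun hk1 A hA hcard => ?_⟩
  rcases (show k = 0 ∨ 2 ≤ k by omega) with rfl | hk2
  -- For `k = 0` the modulus is 1, so `B` is the whole cube.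
  · have huniv : middleLayers n 0 = univ := by
      ext x
      simp [mem_middleLayers, Nat.modEq_one]
    rw [huniv] at hcard ⊢
    exact card_eq_iff_eq_univ A |>.1 (by simpa using hcard)
  · exact hA.eq_middleLayers hk2 hk hcard
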